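/- A loop is an algebra $(Q,1,\cdot,\backslash,/)$ satisfying $x1=x=1x$, $x\backslash(xy)=y=x(x\backslash y)$ and $(yx)/x=y=(y/x)x$. For $x\in Q$ put $L_x(y)=xy$, $R_x(y)=yx$, $M_x(y)=y\backslash x$; these are permutations of $Q$. Let $\mathrm{TotMlt}(Q)=\langle L_x,R_x,M_x : x\in Q\rangle$ and let $\mathrm{TotInn}(Q)$ be the stabilizer of $1$ in $\mathrm{TotMlt}(Q)$. A subloop $N$ of $Q$ is normal if $xN=Nx$, $x(yN)=(xy)N$ and $N(xy)=(Nx)y$ for all $x,y\in Q$. A word $W$ in $n\ge 0$ parameters $x_1,\dots,x_n$ is an element of the free group on the letters $K_t$ with $K\in\{L,R,M\}$ and $t$ a loop term in $x_1,\dots,x_n$. For $\bar u=(u_1,\dots,u_n)\in Q^n$, let $W_{\bar u}\in\mathrm{TotMlt}(Q)$ be the permutation obtained by replacing each letter $K_t$ by the translation $K_{t(\bar u)}$. Let $\mathcal V$ be a variety of loops, i.e. the class of all loops that satisfy a given set of identities. A word $W$ is inner for $\mathcal V$ if $W_{\bar u}\in\mathrm{TotInn}(Q)$ for all $Q\in\mathcal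 V$ and all tuples $\bar u$ in $Q$. A set $\mathcal W$ of words inner for $\mathcal V$ (the number of parameters may vary with the word) generates total inner mapping groups in $\mathcal V$ if $\mathrm{TotInn}(Q)=\langle W_{\bar u} : W\in\mathcal W,\ \bar u \text{ a tuple in } Q\rangle$ for every $Q\in\mathcal V$. For congruences $\alpha,\beta,\delta$ of $Q$, write $C(\alpha,\beta;\delta)$ if for every $n\ge 0$, every $(n+1)$-ary loop term $t$, all $a\mathrel{\alpha}b$ and all $u_i\mathrel{\beta}v_i$ $(1\le i\le n)$, $$t(a,u_1,\dots,u_n)\mathrel{\delta}t(a,v_1,\dots,v_n)\quad\text{implies}\quad t(b,u_1,\dots,u_n)\mathrel{\delta}t(b,v_1,\dots,v_n).$$ Let $[\alpha,\beta]$ be the smallest congruence $\delta$ of $Q$ with $C(\alpha,\beta;\delta)$. For a normal subloop $N$ of $Q$ let $\gamma_N$ be the congruence defined by $a\mathrel{\gamma_N}b$ iff $a/b\in N$. For normal subloops $A,B$ of $Q$ let $[A,B]_Q=\{a\in Q : a\mathrel{[\gamma_A,\gamma_B]}1\}$. **Theorem.** Let $\mathcal V$ be a variety of loops and let $\mathcal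 W$ be a set of words that generates total inner mapping groups in $\mathcal V$. Then for every $Q\in\mathcal V$ and all normal subloops $A,B$ of $Q$, $[A,B]_Q$ is the smallest normal subloop of $Q$ containing all elements $$W_{\bar u}(a)/W_{\bar v}(a),$$ where $W\in\mathcal W$, $a\in A$, and $\bar u,\bar v$ are tuples in $Q$ (of length the number of parameters of $W$) with $u_i/v_i\in B$ for every $i$. -/

import Mathlib

universe u

namespace LoopTheory

/-! ### Loops, subloops, congruences -/

/-- A loop, as a universal algebra `(Q, 1, ·, \, /)`. -/
class Loop (Q : Type u) extends MulOneClass Q, Div Q where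
  /-- The left division `x \ y`. -/
  ldiv : Q → Q → Q
  ldiv_mul : ∀ x y : Q, ldiv x (x * y) = y
  mul_ldiv : ∀ x y : Q, x * ldiv x y = y
  mul_div : ∀ x y : Q, (y * x) / x = y
  div_mul : ∀ x y : Q, (y / x) * x = y

infixl:70 " ⧹ " => Loop.ldiv

/-- A subloop: a subset containing `1` and closed under the three binary operations. -/
structure Subloop (Q : Type u) [Loop Q] where
  carrier : Set Q
  one_mem' : (1 : Q) ∈ carrier
  mul_mem' : ∀ {x y : Q}, x ∈ carrier → y ∈ carrier → x * y ∈ carrier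
  ldiv_mem' : ∀ {x y : Q}, x ∈ carrier → y ∈ carrier → x ⧹ y ∈ carrier
  div_mem' : ∀ {x y : Q}, x ∈ carrier → y ∈ carrier → x / y ∈ carrier

instance {Q : Type u} [Loop Q] : SetLike (Subloop Q) Q where
  coe := Subloop.carrier
  coe_injective := by
    rintro ⟨A, _, _, _, _⟩ ⟨B, _, _, _, _⟩ h
    cases h
    rfl

/-- Subloops are ordered by inclusion. -/
instance {Q : Type u} [Loop Q] : PartialOrder (Subloop Q) :=
  PartialOrder.lift (fun A : Subloop Q => (A : Set Q)) SetLike.coe_injective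

/-- A subloop `N` is normal if `xN = Nx`, `x(yN) = (xy)N` and `N(xy) = (Nx)y` for all `x, y`. -/
structure Subloop.Normal {Q : Type u} [Loop Q] (N : Subloop Q) : Prop where
  comm : ∀ x : Q, (fun n => x * n) '' (N : Set Q) = (fun n => n * x) '' (N : Set Q)
  left : ∀ x y : Q,
    (fun n => x * (y * n)) '' (N : Set Q) = (fun n => (x * y) * n) '' (N : Set Q)
  right : ∀ x y : Q,
    (fun n => n * (x * y)) '' (N : Set Q) = (fun n => (n * x) * y) '' (N : Set Q)

/-- A congruence of a loop: an equivalence relation compatible with `·`, `\` and `/`. -/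
structure Congruence (Q : Type u) [Loop Q] where
  rel : Q → Q → Prop
  equiv : Equivalence rel
  mul : ∀ {a b c d : Q}, rel a b → rel c d → rel (a * c) (b * d)
  ldiv : ∀ {a b c d : Q}, rel a b → rel c d → rel (a ⧹ c) (b ⧹ d)
  div : ∀ {a b c d : Q}, rel a b → rel c d → rel (a / c) (b / d)

/-- Congruences are ordered by inclusion of relations. -/
instance {Q : Type u} [Loop Q] : PartialOrder (Congruence Q) :=
  PartialOrder.lift Congruence.rel (by
    rintro ⟨r, _, _, _, _⟩ ⟨s, _, _, _, _⟩ h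
    cases h
    rfl)

section Cancellation

variable {Q : Type u} [Loop Q]

theorem mul_left_cancel' {x y z : Q} (h : x * y = x * z) : y = z := by
  rw [← Loop.ldiv_mul x y, h, Loop.ldiv_mul]

theorem mul_right_cancel' {x y z : Q} (h : y * x = z * x) : y = z := by
  rw [← Loop.mul_div x y, h, Loop.mul_div]

theorem ldiv_self' (x : Q) : x ⧹ x = 1 := by
  simpa using Loop.ldiv_mul x 1

theorem div_self'' (x : Q) : x / x = 1 := by
  simpa using Loop.mul_div x 1

theorem Subloop.div_mem_iff (N : Subloop Q) (a b : Q) : a / b ∈ N ↔ ∃ n ∈ N, n * b = a := by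
  constructor
  · intro h
    exact ⟨a / b, h, Loop.div_mul b a⟩
  · rintro ⟨n, hn, rfl⟩
    rwa [Loop.mul_div]

end Cancellation

/-- The congruence `γ_N` of a normal subloop `N`: `a γ_N b` iff `a / b ∈ N`. -/
def Subloop.toCongruence {Q : Type u} [Loop Q] (N : Subloop Q) (hN : N.Normal) :
    Congruence Q :=
  have symm : ∀ {a b : Q}, a / b ∈ N → b / a ∈ N := by
    intro a b h
    obtain ⟨n, hn, rfl⟩ := (N.div_mem_iff a b).1 h
    have h1 : b ∈ (fun m => (m * n) * b) '' (N : Set Q) :=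
      ⟨1 / n, N.div_mem' N.one_mem' hn, by simp [Loop.div_mul]⟩
    rw [← hN.right] at h1
    exact (N.div_mem_iff _ _).2 h1
  have trans : ∀ {a b c : Q}, a / b ∈ N → b / c ∈ N → a / c ∈ N := by
    intro a b c h1 h2
    obtain ⟨m, hm, rfl⟩ := (N.div_mem_iff b c).1 h2
    obtain ⟨n, hn, rfl⟩ := (N.div_mem_iff _ _).1 h1
    have h3 : n * (m * c) ∈ (fun k => k * (m * c)) '' (N : Set Q) := ⟨n, hn, rfl⟩
    rw [hN.right] at h3
    obtain ⟨k, hk, hk'⟩ := h3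
    exact (N.div_mem_iff _ _).2 ⟨k * m, N.mul_mem' hk hm, hk'⟩
  have mulR : ∀ {a b : Q} (c : Q), a / b ∈ N ↔ (a * c) / (b * c) ∈ N := by
    intro a b c
    rw [N.div_mem_iff, N.div_mem_iff]
    have h := Set.ext_iff.1 (hN.right b c) (a * c)
    constructor
    · rintro ⟨n, hn, rfl⟩
      exact h.2 ⟨n, hn, rfl⟩
    · intro h'
      obtain ⟨n, hn, e⟩ := h.1 h'
      exact ⟨n, hn, mul_right_cancel' e⟩
  have mulL : ∀ {a b : Q} (c : Q), a / b ∈ N ↔ (c * a) / (c * b) ∈ N := by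
    intro a b c
    rw [N.div_mem_iff, N.div_mem_iff]
    have h := Set.ext_iff.1 (hN.left c b) (c * a)
    rw [hN.comm (c * b)] at h
    have h' := Set.ext_iff.1 (hN.comm b) a
    constructor
    · intro h0
      obtain ⟨n, hn, e⟩ := h'.2 h0
      exact h.1 ⟨n, hn, congrArg (c * ·) e⟩
    · intro h0
      obtain ⟨n, hn, e⟩ := h.2 h0
      exact h'.1 ⟨n, hn, mul_left_cancel' e⟩
  { rel := fun a b => a / b ∈ N
    equiv :=
      { refl := fun a => by rw [div_self'']; exact N.one_mem'
        symm := symm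
        trans := trans }
    mul := fun {_ b c _} h1 h2 => trans ((mulR c).1 h1) ((mulL b).1 h2)
    ldiv := fun {a b c d} h1 h2 => by
      refine (mulL b).2 ?_
      rw [Loop.mul_ldiv]
      have h3 := (mulR (a ⧹ c)).1 h1
      rw [Loop.mul_ldiv] at h3
      exact trans (symm h3) h2
    div := fun {a b c d} h1 h2 => by
      refine (mulR d).2 ?_
      rw [Loop.div_mul]
      have h3 := (mulL (a / c)).1 h2
      rw [Loop.div_mul] at h3
      exact trans (symm h3) h1 }

/-- The subloop `N_α = {a | a α 1}` of a congruence `α`. -/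
def Congruence.toSubloop {Q : Type u} [Loop Q] (α : Congruence Q) : Subloop Q where
  carrier := {a | α.rel a 1}
  one_mem' := α.equiv.refl 1
  mul_mem' := fun {x y} hx hy => by
    have h := α.mul hx hy
    rwa [mul_one] at h
  ldiv_mem' := fun {x y} hx hy => by
    have h := α.ldiv hx hy
    rwa [ldiv_self'] at h
  div_mem' := fun {x y} hx hy => by
    have h := α.div hx hy
    rwa [div_self''] at h

/-! ### Terms and varieties -/

/-- Loop terms over a set `X` of variables. -/
inductive Term (X : Type) : Type
  | var : X → Term X
  | one : Term X
  | mul : Term X → Term X → Term X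
  | ldiv : Term X → Term X → Term X
  | div : Term X → Term X → Term X

/-- The value of a term in a loop under an assignment of the variables. -/
def Term.eval {X : Type} {Q : Type u} [Loop Q] (v : X → Q) : Term X → Q
  | .var x => v x
  | .one => 1
  | .mul s t => s.eval v * t.eval v
  | .ldiv s t => s.eval v ⧹ t.eval v
  | .div s t => s.eval v / t.eval v

/-- A variety of loops, presented by a set of identities `s = t` in countably many variables. -/
structure Variety where
  identities : Set (Term ℕ × Term ℕ)

/-- The loop `Q` belongs to the variety `V`: it satisfies all the identities of `V`. -/
def Variety.Mem (V : Variety) (Q : Type u) [Loop Q] : Prop :=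
  ∀ e ∈ V.identities, ∀ v : ℕ → Q, e.1.eval v = e.2.eval v

/-! ### The commutator -/

/-- `C(α, β; δ)`: `α` centralizes `β` over `δ`, by the term condition for all terms. -/
def Centralizes {Q : Type u} [Loop Q] (α β δ : Congruence Q) : Prop :=
  ∀ (n : ℕ) (t : Term (Fin (n + 1))) (a b : Q) (p q : Fin n → Q),
    α.rel a b → (∀ i, β.rel (p i) (q i)) →
    δ.rel (t.eval (Fin.cons a p : Fin (n + 1) → Q)) (t.eval (Fin.cons a q : Fin (n + 1) → Q)) →
    δ.rel (t.eval (Fin.cons b p : Fin (n + 1) → Q)) (t.eval (Fin.cons b q : Fin (n + 1) → Q))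

/-- The commutator `[α, β]`: the intersection of all congruences `δ` with `C(α, β; δ)`,
which is the smallest such congruence by `congruenceCommutator_isLeast`. -/
def congruenceCommutator {Q : Type u} [Loop Q] (α β : Congruence Q) : Congruence Q where
  rel a b := ∀ δ : Congruence Q, Centralizes α β δ → δ.rel a b
  equiv :=
    { refl := fun a δ _ => δ.equiv.refl a
      symm := fun h δ hδ => δ.equiv.symm (h δ hδ)
      trans := fun h h' δ hδ => δ.equiv.trans (h δ hδ) (h' δ hδ) }
  mul := fun h h' δ hδ => δ.mul (h δ hδ) (h' δ hδ)
  ldiv := fun h h' δ hδ => δ.ldiv (h δ hδ) (h' δ hδ)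
  div := fun h h' δ hδ => δ.div (h δ hδ) (h' δ hδ)

theorem congruenceCommutator_isLeast {Q : Type u} [Loop Q] (α β : Congruence Q) :
    IsLeast {δ : Congruence Q | Centralizes α β δ} (congruenceCommutator α β) :=
  ⟨fun n t a b p q hab hpq h δ hδ => hδ n t a b p q hab hpq (h δ hδ),
    fun δ hδ _ _ h => h δ hδ⟩

/-- The commutator `[A, B]_Q = N_{[γ_A, γ_B]}` of two normal subloops. -/
def commutator {Q : Type u} [Loop Q] (A B : Subloop Q) (hA : A.Normal) (hB : B.Normal) :
    Subloop Q :=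
  (congruenceCommutator (A.toCongruence hA) (B.toCongruence hB)).toSubloop

/-! ### Translations, inner mappings and words -/

/-- The three types of translations. -/
inductive Letter : Type
  | L
  | R
  | M

/-- The translations `L_x(y) = xy`, `R_x(y) = yx` and `M_x(y) = y \ x`. -/
def Letter.translation {Q : Type u} [Loop Q] : Letter → Q → Equiv.Perm Q
  | .L, x =>
    { toFun := fun y => x * y
      invFun := fun y => x ⧹ y
      left_inv := fun y => Loop.ldiv_mul x y
      right_inv := fun y => Loop.mul_ldiv x y }
  | .R, x =>
    { toFun := fun y => y * x
      invFun := fun y => y / x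
      left_inv := fun y => Loop.mul_div x y
      right_inv := fun y => Loop.div_mul x y }
  | .M, x =>
    { toFun := fun y => y ⧹ x
      invFun := fun y => x / y
      left_inv := fun y => by
        have h := Loop.mul_div (y ⧹ x) y
        rwa [Loop.mul_ldiv] at h
      right_inv := fun y => by
        have h := Loop.ldiv_mul (x / y) y
        rwa [Loop.div_mul] at h }

/-- The total multiplication group, generated by all `L_x`, `R_x`, `M_x`. -/
def totMlt (Q : Type u) [Loop Q] : Subgroup (Equiv.Perm Q) :=
  Subgroup.closure {f | ∃ (K : Letter) (x : Q), f = K.translation x}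

/-- The total inner mapping group: the stabilizer of `1` in the total multiplication group. -/
def totInn (Q : Type u) [Loop Q] : Subgroup (Equiv.Perm Q) :=
  totMlt Q ⊓ MulAction.stabilizer (Equiv.Perm Q) (1 : Q)

/-- Words in `n` parameters: elements of the free group on the letters `K_t`,
where `K` is `L`, `R` or `M` and `t` is a loop term in `n` variables. -/
abbrev Word (n : ℕ) : Type := FreeGroup (Letter × Term (Fin n))

/-- The mapping `W_a : Q → Q` induced by a word `W` and a tuple `a` of parameters. -/
def Word.eval {n : ℕ} {Q : Type u} [Loop Q] (W : Word n) (a : Fin n → Q) : Equiv.Perm Q :=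
  FreeGroup.lift (fun k : Letter × Term (Fin n) => k.1.translation (k.2.eval a)) W

/-- A word is inner for `V` if all mappings induced by it in loops of `V` are
total inner mappings. -/
def Word.IsInner {n : ℕ} (W : Word n) (V : Variety) : Prop :=
  ∀ (Q : Type u) [Loop Q], V.Mem Q → ∀ a : Fin n → Q, W.eval a ∈ totInn Q

/-- The set `S` of words (each with its own number of parameters) generates total inner mapping
groups in `V`: it consists of inner words for `V`, and for every `Q` in `V` the mappings induced
by the words of `S` generate the total inner mapping group of `Q`. -/
def GeneratesTotInn (S : Set (Σ n : ℕ, Word n)) (V : Variety) : Prop :=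
  (∀ W ∈ S, Word.IsInner.{u} W.2 V) ∧
  ∀ (Q : Type u) [Loop Q], V.Mem Q →
    totInn Q =
      Subgroup.closure {f | ∃ W ∈ S, ∃ a : Fin W.1 → Q, f = Word.eval W.2 a}

end LoopTheory

namespace LoopTheory

/-! A word induces the same mapping as a term `t(x, u)`, and inner words fix `1`, so the term
condition passed from `1` to `a` puts every `W_u(a) / W_v(a)` into `[A, B]_Q`.

For minimality, let `N` be normal and contain these elements, with `β = γ_B` and `δ = γ_N`. The
generation hypothesis is applied not to `Q` but to `β`, viewed as a subloop of `Q × Q`, which lies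
in the same variety. In it, `K = {(x, y) : x, y ∈ A, x δ y}` is preserved by every generator
`W_(p,q)`, since `W_p x δ W_q x δ W_q y` (`Subloop.pairs_word_mem`). Hence `K` is normal in `β`. Its
congruence identifies `(a, a)` with `(b, b)` whenever `a / b ∈ A`, which yields `C(γ_A, γ_B; γ_N)`
(`centralizes_of_pairs_normal`). -/

/-! ### Homomorphisms -/

/-- A map between loops that respects all the loop operations. -/
structure IsLoopHom {Q P : Type*} [Loop Q] [Loop P] (φ : Q → P) : Prop where
  map_one : φ 1 = 1
  map_mul : ∀ x y, φ (x * y) = φ x * φ y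
  map_ldiv : ∀ x y, φ (x ⧹ y) = φ x ⧹ φ y
  map_div : ∀ x y, φ (x / y) = φ x / φ y

section Hom

variable {Q P : Type*} [Loop Q] [Loop P] {φ : Q → P}

theorem IsLoopHom.map_eval (hφ : IsLoopHom φ) {X : Type} (t : Term X) (v : X → Q) :
    φ (t.eval v) = t.eval (φ ∘ v) := by
  induction t with
  | var x => rfl
  | one => exact hφ.map_one
  | mul s t hs ht => simp only [Term.eval, hφ.map_mul, hs, ht]
  | ldiv s t hs ht => simp only [Term.eval, hφ.map_ldiv, hs, ht]
  | div s t hs ht => simp only [Term.eval, hφ.map_div, hs, ht]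

theorem IsLoopHom.map_translation (hφ : IsLoopHom φ) (K : Letter) (x y : Q) :
    φ (K.translation x y) = K.translation (φ x) (φ y) := by
  cases K
  · exact hφ.map_mul x y
  · exact hφ.map_mul y x
  · exact hφ.map_ldiv y x

theorem Word.eval_of {n : ℕ} (k : Letter × Term (Fin n)) (u : Fin n → Q) :
    Word.eval (FreeGroup.of k) u = k.1.translation (k.2.eval u) := by
  simp [Word.eval]

theorem Word.eval_one {n : ℕ} (u : Fin n → Q) : Word.eval (1 : Word n) u = 1 := by
  simp [Word.eval]

theorem Word.eval_inv {n : ℕ} (W : Word n) (u : Fin n → Q) :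
    Word.eval W⁻¹ u = (Word.eval W u)⁻¹ := by
  simp [Word.eval]

theorem Word.eval_mul {n : ℕ} (W W' : Word n) (u : Fin n → Q) :
    Word.eval (W * W') u = Word.eval W u * Word.eval W' u := by
  simp [Word.eval]

theorem IsLoopHom.map_word_eval (hφ : IsLoopHom φ) {n : ℕ} (W : Word n) (u : Fin n → Q) (x : Q) :
    φ (Word.eval W u x) = Word.eval W (φ ∘ u) (φ x) := by
  induction W using FreeGroup.induction_on generalizing x with
  | C1 => simp [Word.eval_one]
  | of k => rw [Word.eval_of, Word.eval_of, hφ.map_translation, hφ.map_eval]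
  | inv_of k h =>
    rw [Word.eval_inv, Word.eval_inv, Equiv.Perm.eq_inv_iff_eq, ← h]
    simp
  | mul W W' h h' => simp only [Word.eval_mul, Equiv.Perm.mul_apply, h, h']

end Hom

/-! ### Congruences and the total multiplication group -/

section Congruence

variable {Q : Type u} [Loop Q]

theorem Congruence.eval (α : Congruence Q) {X : Type} (t : Term X) {v w : X → Q}
    (h : ∀ i, α.rel (v i) (w i)) : α.rel (t.eval v) (t.eval w) := by
  induction t with
  | var x => exact h x
  | one => exact α.equiv.refl 1
  | mul s t hs ht => exact α.mul hs ht
  | ldiv s t hs ht => exact α.ldiv hs ht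
  | div s t hs ht => exact α.div hs ht

theorem translation_mem_totMlt (K : Letter) (x : Q) : K.translation x ∈ totMlt Q :=
  Subgroup.subset_closure ⟨K, x, rfl⟩

theorem Congruence.rel_totMlt (α : Congruence Q) {f : Equiv.Perm Q} (hf : f ∈ totMlt Q)
    {x y : Q} (h : α.rel x y) : α.rel (f x) (f y) := by
  -- A permutation may preserve `α` while its inverse does not, so both are carried through the
  -- induction.
  suffices h2 : (∀ x y, α.rel x y → α.rel (f x) (f y)) ∧
      ∀ x y, α.rel x y → α.rel (f⁻¹ x) (f⁻¹ y) from h2.1 x y h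
  unfold totMlt at hf
  induction hf using Subgroup.closure_induction with
  | mem f hf =>
    obtain ⟨K, z, rfl⟩ := hf
    cases K
    · exact ⟨fun _ _ h => α.mul (α.equiv.refl z) h, fun _ _ h => α.ldiv (α.equiv.refl z) h⟩
    · exact ⟨fun _ _ h => α.mul h (α.equiv.refl z), fun _ _ h => α.div h (α.equiv.refl z)⟩
    · exact ⟨fun _ _ h => α.ldiv h (α.equiv.refl z), fun _ _ h => α.div (α.equiv.refl z) h⟩
  | one => simp
  | mul f g _ _ hf hg =>
    refine ⟨fun x y h => hf.1 _ _ (hg.1 _ _ h), fun x y h => ?_⟩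
    rw [mul_inv_rev]
    exact hg.2 _ _ (hf.2 _ _ h)
  | inv f _ hf => exact ⟨hf.2, fun x y h => by rw [inv_inv]; exact hf.1 x y h⟩

theorem Congruence.rel_one_totInn (α : Congruence Q) {f : Equiv.Perm Q} (hf : f ∈ totInn Q)
    {x : Q} (h : α.rel x 1) : α.rel (f x) 1 := by
  have h1 : f 1 = 1 := hf.2
  simpa only [h1] using α.rel_totMlt hf.1 h

theorem Word.eval_mem_totMlt {n : ℕ} (W : Word n) (u : Fin n → Q) :
    Word.eval W u ∈ totMlt Q := by
  induction W using FreeGroup.induction_on with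
  | C1 => rw [Word.eval_one]; exact one_mem _
  | of k => rw [Word.eval_of]; exact translation_mem_totMlt _ _
  | inv_of k h => rw [Word.eval_inv]; exact inv_mem h
  | mul W W' h h' => rw [Word.eval_mul]; exact mul_mem h h'

theorem one_div' (x : Q) : x / 1 = x := by
  simpa using Loop.mul_div 1 x

theorem Subloop.toCongruence_rel_one (N : Subloop Q) (hN : N.Normal) (x : Q) :
    (N.toCongruence hN).rel x 1 ↔ x ∈ N := by
  change x / 1 ∈ N ↔ x ∈ N
  rw [one_div']

theorem Subloop.totInn_mem (N : Subloop Q) (hN : N.Normal) {f : Equiv.Perm Q} (hf : f ∈ totInn Q)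
    {x : Q} (h : x ∈ N) : f x ∈ N := by
  rw [← N.toCongruence_rel_one hN] at h ⊢
  exact (N.toCongruence hN).rel_one_totInn hf h

/-- If `f⁻¹ * g` is a total inner mapping, then `f` and `g` have the same image of any subset
stable under total inner mappings. -/
theorem image_eq_image_of_totInn {N : Set Q} (hN : ∀ f ∈ totInn Q, ∀ x ∈ N, f x ∈ N)
    {f g : Equiv.Perm Q} (hf : f ∈ totMlt Q) (hg : g ∈ totMlt Q) (h1 : f 1 = g 1) :
    f '' N = g '' N := by
  have key : ∀ {f g : Equiv.Perm Q}, f ∈ totMlt Q → g ∈ totMlt Q → f 1 = g 1 →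
      f '' N ⊆ g '' N := by
    rintro f g hf hg h1 _ ⟨x, hx, rfl⟩
    refine ⟨(g⁻¹ * f) x, hN _ ⟨(totMlt Q).mul_mem ((totMlt Q).inv_mem hg) hf, ?_⟩ x hx, by simp⟩
    change (g⁻¹ * f) 1 = 1
    simp [h1]
  exact (key hf hg h1).antisymm (key hg hf h1.symm)

/-- Each normality condition compares the images of `N` under two products of translations that
agree at `1`. -/
theorem Subloop.normal_of_totInn (N : Subloop Q) (hN : ∀ f ∈ totInn Q, ∀ x ∈ N, f x ∈ N) :
    N.Normal where
  comm x := image_eq_image_of_totInn (N := (N : Set Q)) hN (f := Letter.L.translation x)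
    (g := Letter.R.translation x) (translation_mem_totMlt _ _) (translation_mem_totMlt _ _)
    (by simp [Letter.translation])
  left x y := image_eq_image_of_totInn (N := (N : Set Q)) hN
    (f := Letter.L.translation x * Letter.L.translation y) (g := Letter.L.translation (x * y))
    (mul_mem (translation_mem_totMlt _ _) (translation_mem_totMlt _ _))
    (translation_mem_totMlt _ _) (by simp [Letter.translation])
  right x y := image_eq_image_of_totInn (N := (N : Set Q)) hN
    (f := Letter.R.translation (x * y)) (g := Letter.R.translation y * Letter.R.translation x)
    (translation_mem_totMlt _ _)
    (mul_mem (translation_mem_totMlt _ _) (translation_mem_totMlt _ _))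
    (by simp [Letter.translation])

theorem Congruence.toSubloop_normal (α : Congruence Q) : α.toSubloop.Normal :=
  α.toSubloop.normal_of_totInn fun _ hf _ hx => α.rel_one_totInn hf hx

end Congruence

/-! ### Words as terms -/

/-- The mapping induced by a word is given by a term in the argument and the parameters. -/
theorem Word.exists_term {n : ℕ} (Q : Type u) [Loop Q] (W : Word n) :
    ∃ t : Term (Fin (n + 1)), ∀ (u : Fin n → Q) (x : Q),
      t.eval (Fin.cons x u : Fin (n + 1) → Q) = Word.eval W u x := by
  have rename : ∀ s : Term (Fin n), ∃ s' : Term (Fin (n + 1)), ∀ (u : Fin n → Q) (x : Q),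
      s'.eval (Fin.cons x u : Fin (n + 1) → Q) = s.eval u := by
    intro s
    induction s with
    | var i => exact ⟨.var i.succ, fun _ _ => rfl⟩
    | one => exact ⟨.one, fun _ _ => rfl⟩
    | mul s t hs ht =>
      obtain ⟨s', hs⟩ := hs
      obtain ⟨t', ht⟩ := ht
      exact ⟨.mul s' t', fun u x => by simp only [Term.eval, hs, ht]⟩
    | ldiv s t hs ht =>
      obtain ⟨s', hs⟩ := hs
      obtain ⟨t', ht⟩ := ht
      exact ⟨.ldiv s' t', fun u x => by simp only [Term.eval, hs, ht]⟩
    | div s t hs ht =>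
      obtain ⟨s', hs⟩ := hs
      obtain ⟨t', ht⟩ := ht
      exact ⟨.div s' t', fun u x => by simp only [Term.eval, hs, ht]⟩
  -- With an arbitrary term `r` as argument, a product of words is handled by substitution.
  suffices h : ∀ r : Term (Fin (n + 1)), ∃ t : Term (Fin (n + 1)), ∀ (u : Fin n → Q) (x : Q),
      t.eval (Fin.cons x u : Fin (n + 1) → Q) =
        Word.eval W u (r.eval (Fin.cons x u : Fin (n + 1) → Q)) from h (.var 0)
  induction W using FreeGroup.induction_on with
  | C1 => exact fun r => ⟨r, fun u x => by simp [Word.eval_one]⟩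
  | of k =>
    intro r
    obtain ⟨K, s⟩ := k
    obtain ⟨s', hs⟩ := rename s
    cases K
    · exact ⟨.mul s' r, fun u x => by simp [Word.eval_of, Term.eval, hs, Letter.translation]⟩
    · exact ⟨.mul r s', fun u x => by simp [Word.eval_of, Term.eval, hs, Letter.translation]⟩
    · exact ⟨.ldiv r s', fun u x => by simp [Word.eval_of, Term.eval, hs, Letter.translation]⟩
  | inv_of k _ =>
    intro r
    obtain ⟨K, s⟩ := k
    obtain ⟨s', hs⟩ := rename s
    cases K
    · exact ⟨.ldiv s' r, fun u x => by rw [Word.eval_inv, Word.eval_of, Term.eval, hs]; rfl⟩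
    · exact ⟨.div r s', fun u x => by rw [Word.eval_inv, Word.eval_of, Term.eval, hs]; rfl⟩
    · exact ⟨.div s' r, fun u x => by rw [Word.eval_inv, Word.eval_of, Term.eval, hs]; rfl⟩
  | mul W W' h h' =>
    intro r
    obtain ⟨t', ht'⟩ := h' r
    obtain ⟨t, ht⟩ := h t'
    exact ⟨t, fun u x => by rw [ht, ht', Word.eval_mul, Equiv.Perm.mul_apply]⟩

/-! ### A congruence as a loop of pairs -/

/-- The pairs related by a congruence. -/
def Congruence.Pairs {Q : Type u} [Loop Q] (β : Congruence Q) : Type u :=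
  {x : Q × Q // β.rel x.1 x.2}

section Pairs

variable {Q : Type u} [Loop Q] (β : Congruence Q)

instance : Loop β.Pairs where
  one := ⟨(1, 1), β.equiv.refl 1⟩
  mul x y := ⟨(x.1.1 * y.1.1, x.1.2 * y.1.2), β.mul x.2 y.2⟩
  div x y := ⟨(x.1.1 / y.1.1, x.1.2 / y.1.2), β.div x.2 y.2⟩
  ldiv x y := ⟨(x.1.1 ⧹ y.1.1, x.1.2 ⧹ y.1.2), β.ldiv x.2 y.2⟩
  one_mul x := Subtype.ext (Prod.ext (one_mul x.1.1) (one_mul x.1.2))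
  mul_one x := Subtype.ext (Prod.ext (mul_one x.1.1) (mul_one x.1.2))
  ldiv_mul x y := Subtype.ext (Prod.ext (Loop.ldiv_mul x.1.1 y.1.1) (Loop.ldiv_mul x.1.2 y.1.2))
  mul_ldiv x y := Subtype.ext (Prod.ext (Loop.mul_ldiv x.1.1 y.1.1) (Loop.mul_ldiv x.1.2 y.1.2))
  mul_div x y := Subtype.ext (Prod.ext (Loop.mul_div x.1.1 y.1.1) (Loop.mul_div x.1.2 y.1.2))
  div_mul x y := Subtype.ext (Prod.ext (Loop.div_mul x.1.1 y.1.1) (Loop.div_mul x.1.2 y.1.2))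

theorem Congruence.isLoopHom_fst : IsLoopHom (fun x : β.Pairs => x.1.1) :=
  ⟨rfl, fun _ _ => rfl, fun _ _ => rfl, fun _ _ => rfl⟩

theorem Congruence.isLoopHom_snd : IsLoopHom (fun x : β.Pairs => x.1.2) :=
  ⟨rfl, fun _ _ => rfl, fun _ _ => rfl, fun _ _ => rfl⟩

theorem Variety.Mem.pairs {V : Variety} (hQ : V.Mem Q) : V.Mem β.Pairs := by
  intro e he v
  refine Subtype.ext (Prod.ext ?_ ?_)
  · have h := hQ e he ((fun x : β.Pairs => x.1.1) ∘ v)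
    rwa [← β.isLoopHom_fst.map_eval, ← β.isLoopHom_fst.map_eval] at h
  · have h := hQ e he ((fun x : β.Pairs => x.1.2) ∘ v)
    rwa [← β.isLoopHom_snd.map_eval, ← β.isLoopHom_snd.map_eval] at h

/-- The pairs in `β` with both entries in `A` that are congruent modulo `δ`. -/
def Subloop.pairs (A : Subloop Q) (δ : Congruence Q) : Subloop β.Pairs where
  carrier := {x | x.1.1 ∈ A ∧ x.1.2 ∈ A ∧ δ.rel x.1.1 x.1.2}
  one_mem' := ⟨A.one_mem', A.one_mem', δ.equiv.refl 1⟩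
  mul_mem' h h' := ⟨A.mul_mem' h.1 h'.1, A.mul_mem' h.2.1 h'.2.1, δ.mul h.2.2 h'.2.2⟩
  ldiv_mem' h h' := ⟨A.ldiv_mem' h.1 h'.1, A.ldiv_mem' h.2.1 h'.2.1, δ.ldiv h.2.2 h'.2.2⟩
  div_mem' h h' := ⟨A.div_mem' h.1 h'.1, A.div_mem' h.2.1 h'.2.1, δ.div h.2.2 h'.2.2⟩

variable {β}

/-- An equivalence is needed so that invariance passes to inverses of the generators. Words act on
pairs coordinatewise. -/
theorem Subloop.pairs_word_mem {A : Subloop Q} (hA : A.Normal) {δ : Congruence Q}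
    {n : ℕ} {W : Word n} (hW : ∀ u : Fin n → Q, Word.eval W u ∈ totInn Q)
    (hWδ : ∀ a ∈ A, ∀ p q : Fin n → Q, (∀ i, β.rel (p i) (q i)) →
      δ.rel (Word.eval W p a) (Word.eval W q a))
    (u : Fin n → β.Pairs) (x : β.Pairs) :
    Word.eval W u x ∈ A.pairs β δ ↔ x ∈ A.pairs β δ := by
  have mem_iff : ∀ {f : Equiv.Perm Q}, f ∈ totInn Q → ∀ y, f y ∈ A ↔ y ∈ A := fun {f} hf y =>
    ⟨fun h => by simpa using A.totInn_mem hA (inv_mem hf) h, A.totInn_mem hA hf⟩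
  change ((Word.eval W u x).1.1 ∈ A ∧ (Word.eval W u x).1.2 ∈ A ∧
    δ.rel (Word.eval W u x).1.1 (Word.eval W u x).1.2) ↔
    (x.1.1 ∈ A ∧ x.1.2 ∈ A ∧ δ.rel x.1.1 x.1.2)
  rw [β.isLoopHom_fst.map_word_eval W u x, β.isLoopHom_snd.map_word_eval W u x,
    mem_iff (hW _), mem_iff (hW _)]
  refine and_congr_right fun h1 => and_congr_right fun _ => ?_
  have key := hWδ _ h1 ((fun x : β.Pairs => x.1.1) ∘ u) ((fun x : β.Pairs => x.1.2) ∘ u)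
    fun i => (u i).2
  have hmlt := Word.eval_mem_totMlt W ((fun x : β.Pairs => x.1.2) ∘ u)
  constructor
  · intro h
    simpa using δ.rel_totMlt (inv_mem hmlt) (δ.equiv.trans (δ.equiv.symm key) h)
  · exact fun h => δ.equiv.trans key (δ.rel_totMlt hmlt h)

theorem centralizes_of_pairs_normal {A : Subloop Q} (hA : A.Normal) {δ : Congruence Q}
    (hK : (A.pairs β δ).Normal) : Centralizes (A.toCongruence hA) β δ := by
  intro n t a b p q hab hpq h
  -- One evaluation of `t` in the loop of pairs records both `t(a, p)` and `t(a, q)`.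
  let c : Q → Fin (n + 1) → β.Pairs := fun a =>
    Fin.cons ⟨(a, a), β.equiv.refl a⟩ fun i => ⟨(p i, q i), hpq i⟩
  have fst_c : ∀ a, (t.eval (c a)).1.1 = t.eval (Fin.cons a p : Fin (n + 1) → Q) := fun a => by
    rw [β.isLoopHom_fst.map_eval]
    congr 1
    funext i
    refine Fin.cases rfl (fun j => rfl) i
  have snd_c : ∀ a, (t.eval (c a)).1.2 = t.eval (Fin.cons a q : Fin (n + 1) → Q) := fun a => by
    rw [β.isLoopHom_snd.map_eval]
    congr 1
    funext i
    refine Fin.cases rfl (fun j => rfl) i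
  have key : ((A.pairs β δ).toCongruence hK).rel (t.eval (c a)) (t.eval (c b)) := by
    refine Congruence.eval _ t fun i => ?_
    refine Fin.cases ?_ (fun j => Equivalence.refl (Congruence.equiv _) _) i
    exact ⟨hab, hab, δ.equiv.refl _⟩
  have key2 : δ.rel ((t.eval (c a)).1.1 / (t.eval (c b)).1.1)
    ((t.eval (c a)).1.2 / (t.eval (c b)).1.2) := key.2.2
  rw [fst_c, fst_c, snd_c, snd_c] at key2
  -- This recovers `t(b, ·)` from the quotient `t(a, ·) / t(b, ·)` and `t(a, ·)`.
  have ldiv_div : ∀ x y : Q, (x / y) ⧹ x = y := fun x y => by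
    simpa only [Loop.div_mul] using Loop.ldiv_mul (x / y) y
  simpa only [ldiv_div] using δ.ldiv key2 h

end Pairs

end LoopTheory

theorem theorem2p2 (V : LoopTheory.Variety) (S : Set (Σ n : ℕ, LoopTheory.Word n))
    (hS : LoopTheory.GeneratesTotInn.{u} S V)
    (Q : Type u) [LoopTheory.Loop Q] (hQ : V.Mem Q)
    (A B : LoopTheory.Subloop Q) (hA : A.Normal) (hB : B.Normal) :
    IsLeast
      {N : LoopTheory.Subloop Q | N.Normal ∧
        {x : Q | ∃ W ∈ S, ∃ a ∈ A, ∃ p q : Fin W.1 → Q,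
          (∀ i, p i / q i ∈ B) ∧
          x = LoopTheory.Word.eval W.2 p a / LoopTheory.Word.eval W.2 q a} ⊆ (N : Set Q)}
      (LoopTheory.commutator A B hA hB) := by
  open LoopTheory in
  refine ⟨⟨Congruence.toSubloop_normal _, ?_⟩, ?_⟩
  · rintro _ ⟨W, hW, a, ha, p, q, hpq, rfl⟩ δ hδ
    obtain ⟨t, ht⟩ := Word.exists_term Q W.2
    have fix : ∀ u, Word.eval W.2 u (1 : Q) = 1 := fun u => (hS.1 W hW Q hQ u).2
    have h := hδ W.1 t 1 a p q
      ((A.toCongruence hA).equiv.symm ((A.toCongruence_rel_one hA a).2 ha)) hpq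
      (by rw [ht, ht, fix, fix]; exact δ.equiv.refl 1)
    rw [ht, ht] at h
    simpa only [div_self''] using δ.div h (δ.equiv.refl (Word.eval W.2 q a))
  · rintro N ⟨hN, hSN⟩ x hx
    -- The commutator is contained in every centralizing congruence, so it suffices that `γ_N` is
    -- one.
    refine (N.toCongruence_rel_one hN x).1 (hx _ (centralizes_of_pairs_normal hA ?_))
    refine Subloop.normal_of_totInn _ fun f hf x hx => ?_
    -- Here the generation hypothesis is used in the loop of pairs.
    rw [hS.2 _ (hQ.pairs _)] at hf
    suffices h : ∀ x, f x ∈ A.pairs (B.toCongruence hB) (N.toCongruence hN) ↔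
        x ∈ A.pairs (B.toCongruence hB) (N.toCongruence hN) from (h x).2 hx
    clear hx x
    induction hf using Subgroup.closure_induction with
    | mem f hf =>
      obtain ⟨W, hW, u, rfl⟩ := hf
      exact Subloop.pairs_word_mem hA (hS.1 W hW Q hQ)
        (fun a ha p q hpq => hSN ⟨W, hW, a, ha, p, q, hpq, rfl⟩) u
    | one => exact fun x => Iff.rfl
    | mul f g _ _ hf hg => exact fun x => (hf _).trans (hg x)
    | inv f _ hf => exact fun x => by simpa using (hf (f⁻¹ x)).symm
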